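/- Conventions. A tensor network is described by its diagram, a hypergraph $G=(V,E,w)$ with the tensors as vertices and the dimensions as edges, $w(e)=\log(\text{size of }e)$; an edge is uncontracted if it has a dangling end. For disjoint $A,B\subseteq V$ let $\mathsf{cut}_G(A,B)$ be the total weight of the edges adjacent to both $A$ and $B$, and $\mathsf{cut}_G(A)$ the total weight of the edges connecting $A$ with $V\setminus A$ together with the uncontracted edges adjacent only to $A$. Contracting the tensors represented by $A$ and $B$ (dense tensors, classical matrix multiplication) costs $\exp\big(\mathsf{cut}_G(A)+\mathsf{cut}_G(B)-\mathsf{cut}_G(A,B)\big)$. A contraction tree is a rooted binary tree whose leaves are the vertices of $G$, each occurring once; its cost is the sum of the costs of its contractions. Data. Let $N\ge 2$ and let $G_D$ represent a vector with a Kronecker product structure: it has vertices $v_1,\dots,v_N$, and its only edges are uncontracted edges $e_1,\dots,e_N$, where $e_j$ has size $s_j$, is adjacent to $v_j$ and is to be sketched. Embeddings. Let $\epsilon>0$ and $0<\delta<1$. An embedding is a tensor network $G_E$ whose diagram is a graph with $N_E$ vertices (each uncontracted edge has one adjacent vertex, each contracted edge has two), among whose uncontracted edges are $e_1,\dots,e_N$,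 along which it is contracted with the data; the other uncontracted edges are the output sketch dimensions. Given an ordering of the vertices of $G_E$, the row size of a vertex $v$ is the product of the sizes of the output edges adjacent to $v$ and of the contracted edges from $v$ to higher vertices. Fix constants $a,b_1,b_2>0$. The embedding is admissible with sketch size $m$ if * (accuracy sufficient condition) for some ordering of the vertices, every vertex has row size at least $a\,N_E\log(1/\delta)/\epsilon^2$, and * there is exactly one output sketch dimension, and its size $m$ satisfies $b_1N_E\log(1/\delta)/\epsilon^2\le m\le b_2N_E\log(1/\delta)/\epsilon^2$. Claim. There is a constant $c>0$, depending only on $a,b_1,b_2$, such that for all $N,\epsilon,\delta$ and $s_1,\dots,s_N$ as above, every admissible embedding $G_E$ with a sketch size $m$ smaller than every $s_j$, and every contraction tree $T_B$ of $(G_D,G_E)$, $$\mathrm{cost}(T_B)\;\ge\; c\Big(\sum_{j=1}^N s_j m+N m^{2.5}\Big)\qquad\text{and}\qquad \mathrm{cost}(T_B)\;\ge\; c\,N\Big(\frac{N\log(1/\delta)}{\epsilon^2}\Big)^{2.5}.$$ That is, $\mathrm{cost}(T_B)=\Omega\big(\sum_j s_jm+Nm^{2.5}\big)$, and in the term $Nm^{2.5}$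 one may take $m=\Omega(N\log(1/\delta)/\epsilon^2)$ whatever the number $N_E$ of tensors of the embedding. -/

import Mathlib

/-- A tensor diagram: an undirected hypergraph with vertices `V` (the tensors) and hyperedges `E`
(the dimensions). An edge is uncontracted when it has a dangling end. Parallel edges are allowed. -/
structure TensorNetwork (V E : Type*) where
  /-- the vertices adjacent to an edge -/
  adj : E → Set V
  /-- the edges with a dangling end, i.e. the uncontracted ones -/
  dangling : Set E
  /-- the dimension size represented by an edge -/
  size : E → ℕ
  adj_nonempty : ∀ e, (adj e).Nonempty
  adj_nontrivial : ∀ e, e ∉ dangling → (adj e).Nontrivial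
  size_pos : ∀ e, 0 < size e

namespace TensorNetwork

variable {V E : Type*}

/-- The weight of an edge: the natural logarithm of its dimension size. -/
noncomputable def weight (G : TensorNetwork V E) (e : E) : ℝ := Real.log (G.size e)

/-- `E(A, B)`: the edges connecting the vertex sets `A` and `B`. -/
def edgesBetween (G : TensorNetwork V E) (A B : Set V) : Set E :=
  {e | (∃ u ∈ A, u ∈ G.adj e) ∧ ∃ v ∈ B, v ∈ G.adj e}

/-- `E(A, *)`: the uncontracted edges adjacent only to `A`. -/
def edgesOut (G : TensorNetwork V E) (A : Set V) : Set E :=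
  {e | e ∈ G.dangling ∧ G.adj e ⊆ A}

/-- `E(A) = E(A, V \ A) ∪ E(A, *)`: the dimensions of the tensor obtained by contracting `A`. -/
def boundary (G : TensorNetwork V E) (A : Set V) : Set E :=
  G.edgesBetween A Aᶜ ∪ G.edgesOut A

open Classical in
/-- The total weight of a set of edges. -/
noncomputable def totalWeight [Fintype E] (G : TensorNetwork V E) (F : Set E) : ℝ :=
  ∑ e : E with e ∈ F, G.weight e

/-- The logarithm of the cost of contracting the tensors represented by disjoint `A` and `B`:
`cut(A) + cut(B) - cut(A, B)`. -/
noncomputable def logCost [Fintype E] (G : TensorNetwork V E) (A B : Set V) : ℝ :=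
  G.totalWeight (G.boundary A) + G.totalWeight (G.boundary B) - G.totalWeight (G.edgesBetween A B)

end TensorNetwork

/-- Rooted binary trees with leaves labelled by `V`. -/
inductive ContractionTree (V : Type*) where
  | leaf (v : V) : ContractionTree V
  | node (l r : ContractionTree V) : ContractionTree V

namespace ContractionTree

variable {V E : Type*}

/-- The set of vertices represented by (the root of) a tree. -/
def verts : ContractionTree V → Set V
  | leaf v => {v}
  | node l r => l.verts ∪ r.verts

/-- At every contraction the two contracted vertex sets are disjoint. -/
def Proper : ContractionTree V → Prop
  | leaf _ => True
  | node l r => l.Proper ∧ r.Proper ∧ Disjoint l.verts r.verts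

/-- The tree contracts the whole vertex set, each vertex occurring as exactly one leaf. -/
def IsFull (t : ContractionTree V) : Prop := t.Proper ∧ t.verts = Set.univ

/-- The cost of a contraction tree: the sum of the costs of its contractions, each performed as a
classical dense matrix multiplication. -/
noncomputable def cost [Fintype E] (G : TensorNetwork V E) : ContractionTree V → ℝ
  | leaf _ => 0
  | node l r => l.cost G + r.cost G + Real.exp (G.logCost l.verts r.verts)

end ContractionTree

/-- The tensor network `(G_D, G_E)` obtained by connecting `D` and `G` along the edges indexed
by `ι`, which are common to both. -/
def TensorNetwork.attach {ι VD FD VE FE : Type*} (D : TensorNetwork VD (ι ⊕ FD))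
    (G : TensorNetwork VE (ι ⊕ FE)) : TensorNetwork (VD ⊕ VE) (ι ⊕ FD ⊕ FE) where
  adj
    | .inl j => Sum.inl '' D.adj (.inl j) ∪ Sum.inr '' G.adj (.inl j)
    | .inr (.inl f) => Sum.inl '' D.adj (.inr f)
    | .inr (.inr f) => Sum.inr '' G.adj (.inr f)
  dangling := {e | match e with
    | .inl _ => False
    | .inr (.inl f) => .inr f ∈ D.dangling
    | .inr (.inr f) => .inr f ∈ G.dangling}
  size
    | .inl j => D.size (.inl j)
    | .inr (.inl f) => D.size (.inr f)
    | .inr (.inr f) => G.size (.inr f)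
  adj_nonempty
    | .inl j => ((D.adj_nonempty (.inl j)).image _).inl
    | .inr (.inl f) => (D.adj_nonempty (.inr f)).image _
    | .inr (.inr f) => (G.adj_nonempty (.inr f)).image _
  adj_nontrivial
    | .inl j, _ => by
        obtain ⟨u, hu⟩ := D.adj_nonempty (.inl j)
        obtain ⟨v, hv⟩ := G.adj_nonempty (.inl j)
        exact ⟨.inl u, .inl ⟨u, hu, rfl⟩, .inr v, .inr ⟨v, hv, rfl⟩, Sum.inl_ne_inr⟩
    | .inr (.inl f), h => (D.adj_nontrivial (.inr f) h).image Sum.inl_injective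
    | .inr (.inr f), h => (G.adj_nontrivial (.inr f) h).image Sum.inr_injective
  size_pos
    | .inl j => D.size_pos (.inl j)
    | .inr (.inl f) => D.size_pos (.inr f)
    | .inr (.inr f) => G.size_pos (.inr f)

/-- The data network of a Kronecker product `x₁ ⊗ ⋯ ⊗ x_N` of vectors of sizes `s j`: the vertex
`v_j` is adjacent to the single uncontracted edge `e_j` of size `s j`, and there are no other
edges. -/
def kroneckerData {N : ℕ} (s : Fin N → ℕ) (hs : ∀ j, 0 < s j) :
    TensorNetwork (Fin N) (Fin N ⊕ Empty) where
  adj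
    | .inl j => {j}
  dangling := Set.univ
  size
    | .inl j => s j
  adj_nonempty
    | .inl j => Set.singleton_nonempty j
  adj_nontrivial _ h := absurd (Set.mem_univ _) h
  size_pos
    | .inl j => hs j

/-- A tensor network embedding: a graph whose edges are the uncontracted edges `Sum.inl j`, `j : ι`,
to be connected with the data (the columns of the embedding matrix), and the remaining
edges `Sum.inr f`, of which the uncontracted ones form the rows of the embedding matrix. Uncontracted
edges have one adjacent vertex, contracted edges have two. -/
structure TNEmbedding (ι V F : Type*) extends TensorNetwork V (ι ⊕ F) where
  input_dangling : ∀ j, Sum.inl j ∈ dangling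
  adj_of_dangling : ∀ e ∈ dangling, ∃ v, adj e = {v}
  adj_of_contracted : ∀ e ∉ dangling, ∃ u v, u ≠ v ∧ adj e = {u, v}

namespace TNEmbedding

variable {ι V F : Type*}

open Classical in
/-- Given an ordering of the vertices of the embedding, the number of rows of the matricization of
the tensor at `v` in the corresponding linearization: its rows combine the output dimensions and
the dimensions contracted with tensors of higher index. (The other dimensions, among them
those connected with the data, are columns.) -/
noncomputable def rowSize [Fintype V] [Fintype F] (G : TNEmbedding ι V F)
    (ord : V ≃ Fin (Fintype.card V)) (v : V) : ℕ :=
  ∏ f : F with v ∈ G.adj (Sum.inr f) ∧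
    (Sum.inr f ∈ G.dangling ∨ ∃ u ∈ G.adj (Sum.inr f), ord v < ord u), G.size (Sum.inr f)

/-- The accuracy sufficient condition, with constant `a` in its `Ω`: in some linearization every
tensor has row size at least `a * N_E * log (1 / δ) / ε ^ 2`, where `N_E` is the number of tensors
of the embedding. -/
def SufficientCondition [Fintype V] [Fintype F] (G : TNEmbedding ι V F) (a ε δ : ℝ) : Prop :=
  ∃ ord : V ≃ Fin (Fintype.card V), ∀ v,
    a * (Fintype.card V * Real.log (1 / δ) / ε ^ 2) ≤ G.rowSize ord v

/-- There is exactly one output sketch dimension, and it has size `m`. -/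
def HasOutputSize (G : TNEmbedding ι V F) (m : ℕ) : Prop :=
  ∃ f, (∀ f', Sum.inr f' ∈ G.dangling ↔ f' = f) ∧ G.size (Sum.inr f) = m

/-- The admissible embeddings of sketch size `m`: they satisfy the sufficient condition, and have
one output sketch dimension, of size `m = Θ(N_E * log (1 / δ) / ε ^ 2)`. The constants in `Ω` and
`Θ` are `a` and `b₁, b₂`. -/
structure Admissible [Fintype V] [Fintype F] (G : TNEmbedding ι V F) (a b₁ b₂ ε δ : ℝ) (m : ℕ) :
    Prop where
  sufficient : G.SufficientCondition a ε δ
  output : G.HasOutputSize m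
  lower : b₁ * (Fintype.card V * Real.log (1 / δ) / ε ^ 2) ≤ m
  upper : m ≤ b₂ * (Fintype.card V * Real.log (1 / δ) / ε ^ 2)

end TNEmbedding

namespace TensorNetwork

variable {V E : Type*}

/-! Order the vertices with the data first and then the embedding in its given order. Every edge
then runs upwards or to the outside, and by the row-size condition every vertex has outgoing weight
at least `log x`, where `x` is a constant multiple of `m`. Because the diagram is a graph, the
log-cost of a contraction is the weight of the union of the two boundaries (`logCost_eq`), so each
family of disjoint edge sets found there bounds the cost below. Three bounds follow.

Sum of `s j * m` (`mul_sum_le_cost`): each data edge is absorbed at exactly one contraction, where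
the outgoing edges of the highest vertex present are also open and contribute a factor `x`.

`N * m ^ 2.5` (`mul_rpow_le_cost`): a contraction is charged when it costs at least `x ^ 2.5`. Three
graded inequalities, collected in `LeafBound`, pass through an uncharged contraction: it is so
narrow that few edges can leave below the top vertex, and unless the upper operand has large
incoming weight, the union has large low outgoing weight. At the root there is a single outgoing
edge, so all but one of the data leaves are paid for.

Independence of the number of tensors (`rpow_div_card_le_cost`): with few tensors, many data edges
meet at a typical one. Its size is exponential in that number and is itself bounded by the cost.
With many tensors, `m` is already of order `N * log (1 / δ) / ε ^ 2` and the second bound suffices.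
-/

lemma weight_nonneg (G : TensorNetwork V E) (e : E) : 0 ≤ G.weight e :=
  Real.log_nonneg (by exact_mod_cast G.size_pos e)

/-! ### Weights of sets of edges -/

section TotalWeight

variable [Fintype E] (G : TensorNetwork V E)

lemma totalWeight_nonneg (F : Set E) : 0 ≤ G.totalWeight F :=
  Finset.sum_nonneg fun e _ => G.weight_nonneg e

lemma totalWeight_mono {F F' : Set E} (h : F ⊆ F') : G.totalWeight F ≤ G.totalWeight F' := by
  classical
  unfold totalWeight
  refine Finset.sum_le_sum_of_subset_of_nonneg ?_ fun e _ _ => G.weight_nonneg e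
  intro e he
  simp only [Finset.mem_filter, Finset.mem_univ, true_and] at he ⊢
  exact h he

lemma totalWeight_empty : G.totalWeight ∅ = 0 := by
  simp [totalWeight]

lemma totalWeight_union {F F' : Set E} (h : Disjoint F F') :
    G.totalWeight (F ∪ F') = G.totalWeight F + G.totalWeight F' := by
  classical
  unfold totalWeight
  simp only [Finset.sum_filter]
  rw [← Finset.sum_add_distrib]
  refine Finset.sum_congr rfl fun e _ => ?_
  have : e ∈ F → e ∉ F' := fun h' => Set.disjoint_left.mp h h'
  by_cases h1 : e ∈ F <;> by_cases h2 : e ∈ F' <;> simp_all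

lemma totalWeight_union_le (F F' : Set E) :
    G.totalWeight (F ∪ F') ≤ G.totalWeight F + G.totalWeight F' := by
  rw [← Set.union_sdiff_self, totalWeight_union G Set.disjoint_sdiff_right]
  linarith [G.totalWeight_mono (F := F' \ F) (F' := F') Set.sdiff_subset]

lemma add_totalWeight_le {F F' K : Set E} (h : Disjoint F F') (hF : F ⊆ K) (hF' : F' ⊆ K) :
    G.totalWeight F + G.totalWeight F' ≤ G.totalWeight K := by
  rw [← G.totalWeight_union h]
  exact G.totalWeight_mono (Set.union_subset hF hF')

lemma add_add_totalWeight_le {F₁ F₂ F₃ K : Set E} (h₁₂ : Disjoint F₁ F₂) (h₁₃ : Disjoint F₁ F₃)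
    (h₂₃ : Disjoint F₂ F₃) (h₁ : F₁ ⊆ K) (h₂ : F₂ ⊆ K) (h₃ : F₃ ⊆ K) :
    G.totalWeight F₁ + G.totalWeight F₂ + G.totalWeight F₃ ≤ G.totalWeight K := by
  rw [← G.totalWeight_union h₁₂]
  exact G.add_totalWeight_le (Set.disjoint_union_left.mpr ⟨h₁₃, h₂₃⟩) (Set.union_subset h₁ h₂) h₃

end TotalWeight

/-! ### Acyclic orientations and the edges open at a contraction -/

/-- An acyclic orientation of a tensor network whose diagram is a graph: every edge goes from its
tail to a head of higher rank, or to the outside when it is uncontracted. -/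
structure Orientation (G : TensorNetwork V E) where
  /-- the position of a vertex in a linear order -/
  rank : V → ℕ
  /-- the tail of an edge -/
  tail : E → V
  /-- the head of an edge, `none` when the edge is uncontracted -/
  head : E → Option V
  rank_injective : Function.Injective rank
  adj_eq : ∀ e, G.adj e = {v | v = tail e ∨ head e = some v}
  dangling_iff : ∀ e, e ∈ G.dangling ↔ head e = none
  rank_lt : ∀ e u, head e = some u → rank (tail e) < rank u

namespace Orientation

variable {G : TensorNetwork V E} (O : G.Orientation)

/-- The edges with tail `v`. -/
def outEdges (v : V) : Set E := {e | O.tail e = v}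

/-- The edges with tail in `A` and head outside of `A`. -/
def leaving (A : Set V) : Set E := {e | O.tail e ∈ A ∧ ∀ u ∈ A, O.head e ≠ some u}

/-- The edges with tail outside of `A` and head in `A`. -/
def entering (A : Set V) : Set E := {e | O.tail e ∉ A ∧ ∃ u ∈ A, O.head e = some u}

/-- The edges leaving `A` from a vertex other than the highest one. -/
def lowLeaving (A : Set V) : Set E :=
  {e | e ∈ O.leaving A ∧ ∃ u ∈ A, O.rank (O.tail e) < O.rank u}

/-- The vertex `t` is the highest one of `A`. -/
def IsTop (A : Set V) (t : V) : Prop := t ∈ A ∧ ∀ u ∈ A, O.rank u ≤ O.rank t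

lemma boundary_eq (A : Set V) : G.boundary A = O.leaving A ∪ O.entering A := by
  ext e
  have hr := O.rank_lt e
  simp only [boundary, edgesBetween, edgesOut, leaving, entering, O.adj_eq, O.dangling_iff,
    Set.mem_union, Set.mem_ofPred_eq, Set.mem_compl_iff, Set.subset_def]
  cases h : O.head e with
  | none => simp_all
  | some u =>
    by_cases h1 : O.tail e ∈ A <;> by_cases h2 : u ∈ A <;> simp_all <;> grind

/-- Inclusion-exclusion: an edge has at most two ends, so the edges between disjoint `A` and `B` are
exactly those in both boundaries. A hyperedge with a further end would break this. -/
lemma logCost_eq (O : G.Orientation) [Fintype E] {A B : Set V} (hAB : Disjoint A B) :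
    G.logCost A B = G.totalWeight (G.boundary A ∪ G.boundary B) := by
  classical
  have hd : ∀ v ∈ A, v ∉ B := fun _ h => Set.disjoint_left.mp hAB h
  unfold logCost totalWeight
  simp only [Finset.sum_filter]
  rw [← Finset.sum_add_distrib, ← Finset.sum_sub_distrib]
  refine Finset.sum_congr rfl fun e _ => ?_
  have key : e ∈ G.edgesBetween A B ↔ e ∈ G.boundary A ∧ e ∈ G.boundary B := by
    rw [O.boundary_eq, O.boundary_eq]
    simp only [edgesBetween, leaving, entering, O.adj_eq, Set.mem_union, Set.mem_ofPred_eq]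
    have h1 := hd (O.tail e)
    cases h : O.head e with
    | none => simp_all
    | some u => have h2 := hd u; simp_all; grind
  by_cases h1 : e ∈ G.boundary A <;> by_cases h2 : e ∈ G.boundary B <;>
    simp [key, h1, h2]

lemma lowLeaving_subset (A : Set V) : O.lowLeaving A ⊆ O.leaving A := fun _ h => h.1

lemma leaving_subset (A : Set V) : O.leaving A ⊆ G.boundary A := by
  rw [O.boundary_eq]; exact Set.subset_union_left

lemma entering_subset (A : Set V) : O.entering A ⊆ G.boundary A := by
  rw [O.boundary_eq]; exact Set.subset_union_right

lemma IsTop.outEdges_subset {A : Set V} {t : V} (h : O.IsTop A t) :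
    O.outEdges t ⊆ O.leaving A := by
  intro e he
  have he : O.tail e = t := he
  refine ⟨he ▸ h.1, fun u hu hhead => ?_⟩
  have := O.rank_lt e u hhead
  have := h.2 u hu
  rw [he] at *
  omega

lemma IsTop.disjoint_lowLeaving {A : Set V} {t : V} (h : O.IsTop A t) :
    Disjoint (O.outEdges t) (O.lowLeaving A) := by
  rw [Set.disjoint_left]
  rintro e he ⟨-, u, hu, hlt⟩
  have he : O.tail e = t := he
  have := h.2 u hu
  rw [he] at hlt
  omega

section Merge

variable [Fintype E] {A B : Set V} {b : V} (hAB : Disjoint A B) (hb : O.IsTop B b)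
  (hA : ∀ u ∈ A, O.rank u < O.rank b)
include hAB hb

lemma outEdges_add_leaving_add_lowLeaving_le :
    G.totalWeight (O.outEdges b) + G.totalWeight (O.leaving A) + G.totalWeight (O.lowLeaving B) ≤
      G.logCost A B := by
  rw [O.logCost_eq hAB]
  have hd : ∀ v ∈ A, v ∉ B := fun _ h => Set.disjoint_left.mp hAB h
  refine G.add_add_totalWeight_le ?_ (hb.disjoint_lowLeaving) ?_ ?_ ?_ ?_
  · rw [Set.disjoint_left]
    rintro e he ⟨h1, -⟩
    exact hd _ h1 ((show O.tail e = b from he) ▸ hb.1)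
  · rw [Set.disjoint_left]
    rintro e ⟨h1, -⟩ ⟨⟨h2, -⟩, -⟩
    exact hd _ h1 h2
  · exact (hb.outEdges_subset.trans (O.leaving_subset B)).trans Set.subset_union_right
  · exact (O.leaving_subset A).trans Set.subset_union_left
  · exact ((O.lowLeaving_subset B).trans (O.leaving_subset B)).trans Set.subset_union_right

include hA in
lemma outEdges_add_leaving_add_entering_le :
    G.totalWeight (O.outEdges b) + G.totalWeight (O.leaving A) + G.totalWeight (O.entering A) ≤
      G.logCost A B := by
  rw [O.logCost_eq hAB]
  have hd : ∀ v ∈ A, v ∉ B := fun _ h => Set.disjoint_left.mp hAB h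
  refine G.add_add_totalWeight_le ?_ ?_ ?_ ?_ ?_ ?_
  · rw [Set.disjoint_left]
    rintro e he ⟨h1, -⟩
    exact hd _ h1 ((show O.tail e = b from he) ▸ hb.1)
  · rw [Set.disjoint_left]
    rintro e he ⟨-, u, hu, hh⟩
    have := O.rank_lt e u hh
    rw [show O.tail e = b from he] at this
    have := hA u hu
    omega
  · rw [Set.disjoint_left]
    rintro e ⟨h1, -⟩ ⟨h2, -⟩
    exact h2 h1
  · exact (hb.outEdges_subset.trans (O.leaving_subset B)).trans Set.subset_union_right
  · exact (O.leaving_subset A).trans Set.subset_union_left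
  · exact (O.entering_subset A).trans Set.subset_union_left

lemma outEdges_add_leaving_add_entering_union_le :
    G.totalWeight (O.outEdges b) + G.totalWeight (O.leaving A) +
      G.totalWeight (O.entering (A ∪ B)) ≤ G.logCost A B := by
  rw [O.logCost_eq hAB]
  have hd : ∀ v ∈ A, v ∉ B := fun _ h => Set.disjoint_left.mp hAB h
  refine G.add_add_totalWeight_le ?_ ?_ ?_ ?_ ?_ ?_
  · rw [Set.disjoint_left]
    rintro e he ⟨h1, -⟩
    exact hd _ h1 ((show O.tail e = b from he) ▸ hb.1)
  · rw [Set.disjoint_left]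
    rintro e he ⟨h, -⟩
    exact h (.inr ((show O.tail e = b from he) ▸ hb.1))
  · rw [Set.disjoint_left]
    rintro e ⟨h1, -⟩ ⟨h2, -⟩
    exact h2 (.inl h1)
  · exact (hb.outEdges_subset.trans (O.leaving_subset B)).trans Set.subset_union_right
  · exact (O.leaving_subset A).trans Set.subset_union_left
  · rintro e ⟨h, u, hu | hu, hh⟩
    · exact .inl (O.entering_subset A ⟨fun h' => h (.inl h'), u, hu, hh⟩)
    · exact .inr (O.entering_subset B ⟨fun h' => h (.inr h'), u, hu, hh⟩)

include hA in
-- An edge leaving `A` either ends in `B` or still leaves the union, and then from below `b`.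
lemma leaving_le_entering_add_lowLeaving_union :
    G.totalWeight (O.leaving A) ≤
      G.totalWeight (O.entering B) + G.totalWeight (O.lowLeaving (A ∪ B)) := by
  have hd : ∀ v ∈ A, v ∉ B := fun _ h => Set.disjoint_left.mp hAB h
  refine (G.totalWeight_mono ?_).trans (G.totalWeight_union_le _ _)
  rintro e ⟨h1, h2⟩
  by_cases h : ∃ u ∈ B, O.head e = some u
  · exact .inl ⟨hd _ h1, h⟩
  · push Not at h
    refine .inr ⟨⟨.inl h1, ?_⟩, b, .inr hb.1, hA _ h1⟩
    rintro u (hu | hu)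
    · exact h2 u hu
    · exact h u hu

end Merge

end Orientation

end TensorNetwork

/-! ### Sums over the leaves of a contraction tree -/

namespace ContractionTree

variable {V : Type*}

/-- The sum of a function over the leaves of a tree. -/
def leafSum (φ : V → ℝ) : ContractionTree V → ℝ
  | leaf v => φ v
  | node l r => l.leafSum φ + r.leafSum φ

lemma verts_nonempty : ∀ t : ContractionTree V, t.verts.Nonempty
  | leaf v => Set.singleton_nonempty v
  | node l _ => l.verts_nonempty.inl

lemma leafSum_eq_sum [Fintype V] (φ : V → ℝ) :
    ∀ t : ContractionTree V, t.Proper → t.leafSum φ = ∑ v, t.verts.indicator φ v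
  | leaf v, _ => by
      classical
      simp [leafSum, verts, Set.indicator_apply]
  | node l r, h => by
      rw [leafSum, leafSum_eq_sum φ l h.1, leafSum_eq_sum φ r h.2.1, ← Finset.sum_add_distrib]
      refine Finset.sum_congr rfl fun v _ => ?_
      rw [verts, Set.indicator_union_of_disjoint h.2.2]

lemma IsFull.leafSum_eq [Fintype V] {t : ContractionTree V} (h : t.IsFull) (φ : V → ℝ) :
    t.leafSum φ = ∑ v, φ v := by
  rw [leafSum_eq_sum φ t h.1, h.2]
  simp

lemma cost_nonneg {E : Type*} [Fintype E] (G : TensorNetwork V E) :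
    ∀ t : ContractionTree V, 0 ≤ t.cost G
  | leaf _ => le_rfl
  | node l r => add_nonneg (add_nonneg (l.cost_nonneg G) (r.cost_nonneg G)) (Real.exp_nonneg _)

end ContractionTree

/-! ### Counting sources in units of `exp (5 / 2 * ℓ)`, and tensor sizes -/

namespace TensorNetwork.Orientation

open ContractionTree

variable {V E : Type*} {G : TensorNetwork V E}

lemma exists_isTop [Finite V] (O : G.Orientation) {A : Set V} (hA : A.Nonempty) :
    ∃ t, O.IsTop A t :=
  Set.exists_max_image A O.rank A.toFinite hA

variable [Fintype E]

lemma logCost_comm (O : G.Orientation) {A B : Set V} (hAB : Disjoint A B) :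
    G.logCost B A = G.logCost A B := by
  rw [O.logCost_eq hAB, O.logCost_eq hAB.symm, Set.union_comm]

lemma totalWeight_boundary_le_left (O : G.Orientation) {A B : Set V} (hAB : Disjoint A B) :
    G.totalWeight (G.boundary A) ≤ G.logCost A B := by
  rw [O.logCost_eq hAB]
  exact G.totalWeight_mono Set.subset_union_left

lemma totalWeight_boundary_le_right (O : G.Orientation) {A B : Set V} (hAB : Disjoint A B) :
    G.totalWeight (G.boundary B) ≤ G.logCost A B := by
  rw [O.logCost_eq hAB]
  exact G.totalWeight_mono Set.subset_union_right

/-- A bound of the number `n` of leaves in a vertex set `A` by the cost `c` of contracting `A`, in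
units of `exp (5 / 2 * ℓ)`. It is sharper when `A` can be contracted further at low cost. -/
structure LeafBound (O : G.Orientation) (ℓ : ℝ) (A : Set V) (n c : ℝ) : Prop where
  le_add_two : Real.exp (5 / 2 * ℓ) * n ≤ 4 * c + 2 * Real.exp (5 / 2 * ℓ)
  le_add_one : G.totalWeight (O.lowLeaving A) < ℓ / 2 →
    Real.exp (5 / 2 * ℓ) * n ≤ 4 * c + Real.exp (5 / 2 * ℓ)
  le : ℓ / 2 ≤ G.totalWeight (O.entering A) → Real.exp (5 / 2 * ℓ) * n ≤ 4 * c

/-- An expensive contraction pays for the defects of both operands, at most two units each, which is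
why the cost has coefficient 4. A cheap one forces both operands into the case of smaller defect. -/
lemma LeafBound.union (O : G.Orientation) {ℓ : ℝ}
    (hout : ∀ v, ℓ ≤ G.totalWeight (O.outEdges v)) {A B : Set V} {a b : V} {nA nB cA cB : ℝ}
    (hA : O.LeafBound ℓ A nA cA) (hB : O.LeafBound ℓ B nB cB) (hAB : Disjoint A B)
    (ha : O.IsTop A a) (hb : O.IsTop B b) (hab : O.rank a < O.rank b) :
    O.LeafBound ℓ (A ∪ B) (nA + nB) (cA + cB + Real.exp (G.logCost A B)) := by
  have hX := Real.exp_pos (5 / 2 * ℓ)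
  have hC := Real.exp_pos (G.logCost A B)
  rcases le_or_gt (5 / 2 * ℓ) (G.logCost A B) with h | h
  · have hXC : Real.exp (5 / 2 * ℓ) ≤ Real.exp (G.logCost A B) := Real.exp_le_exp.mpr h
    have key : Real.exp (5 / 2 * ℓ) * (nA + nB) ≤ 4 * (cA + cB + Real.exp (G.logCost A B)) := by
      linarith [hA.le_add_two, hB.le_add_two]
    exact ⟨by linarith, fun _ => by linarith, fun _ => key⟩
  · have hlow : ∀ u ∈ A, O.rank u < O.rank b := fun u hu => (ha.2 u hu).trans_lt hab
    have h₁ := O.outEdges_add_leaving_add_lowLeaving_le hAB hb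
    have h₂ := O.outEdges_add_leaving_add_entering_le hAB hb hlow
    have h₃ := O.outEdges_add_leaving_add_entering_union_le hAB hb
    have h₄ := O.leaving_le_entering_add_lowLeaving_union hAB hb hlow
    have h₅ := G.add_totalWeight_le (ha.disjoint_lowLeaving) (ha.outEdges_subset)
      (O.lowLeaving_subset A)
    have hoa := hout a
    have hob := hout b
    have e₁ := G.totalWeight_nonneg (O.lowLeaving B)
    have e₂ := G.totalWeight_nonneg (O.entering A)
    have e₃ := G.totalWeight_nonneg (O.lowLeaving A)
    -- The outgoing edges of `a` and `b` already use `2 * ℓ` of the less than `5 / 2 * ℓ` available,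
    -- leaving less than `ℓ / 2` for the low edges of `A` and of `B`. Likewise the union has
    -- entering weight below `ℓ / 2`, so the third inequality is vacuous.
    have bA := hA.le_add_one (by linarith)
    have bB := hB.le_add_one (by linarith)
    refine ⟨by linarith, fun hq => ?_, fun hi => by linarith⟩
    -- `A` has leaving weight at least `ℓ`. As less than `ℓ / 2` of it remains low in the union,
    -- more than `ℓ / 2` enters `B`, so `B` has no defect.
    have := hB.le (by linarith)
    linarith

lemma leafBound_tree [Finite V] (O : G.Orientation) {ℓ : ℝ} (hℓ : 0 < ℓ)
    (hout : ∀ v, ℓ ≤ G.totalWeight (O.outEdges v)) {φ : V → ℝ} (hφ : ∀ v, φ v ≤ 1)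
    (hφ₀ : ∀ v, 0 < G.totalWeight (O.entering {v}) → φ v ≤ 0) :
    ∀ t : ContractionTree V, t.Proper → O.LeafBound ℓ t.verts (t.leafSum φ) (t.cost G)
  | leaf v, _ => by
      have hX := Real.exp_pos (5 / 2 * ℓ)
      have := hφ v
      simp only [verts, leafSum, cost]
      refine ⟨by nlinarith, fun _ => by nlinarith, fun h => ?_⟩
      have := hφ₀ v (by linarith)
      nlinarith
  | node l r, h => by
      have hl := leafBound_tree O hℓ hout hφ hφ₀ l h.1
      have hr := leafBound_tree O hℓ hout hφ hφ₀ r h.2.1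
      obtain ⟨a, ha⟩ := O.exists_isTop l.verts_nonempty
      obtain ⟨b, hb⟩ := O.exists_isTop r.verts_nonempty
      have hne : O.rank a ≠ O.rank b := fun hab =>
        Set.disjoint_left.mp h.2.2 ha.1 (O.rank_injective hab ▸ hb.1)
      simp only [verts, leafSum, cost]
      rcases hne.lt_or_gt with hab | hab
      · exact LeafBound.union O hout hl hr h.2.2 ha hb hab
      · have := LeafBound.union O hout hr hl h.2.2.symm hb ha hab
        rwa [Set.union_comm, add_comm (r.leafSum φ), add_comm (r.cost G),
          O.logCost_comm h.2.2] at this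

/-- If every vertex has outgoing weight at least `ℓ` and only one edge is uncontracted, then the
number of vertices without incoming weight is bounded by the cost in units of `exp (5 / 2 * ℓ)`. -/
theorem exp_mul_sum_le_cost [Fintype V] (O : G.Orientation) {ℓ : ℝ} (hℓ : 0 < ℓ)
    (hout : ∀ v, ℓ ≤ G.totalWeight (O.outEdges v)) (hone : G.dangling.Subsingleton)
    {φ : V → ℝ} (hφ : ∀ v, φ v ≤ 1)
    (hφ₀ : ∀ v, 0 < G.totalWeight (O.entering {v}) → φ v ≤ 0)
    {T : ContractionTree V} (hT : T.IsFull) :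
    Real.exp (5 / 2 * ℓ) * ∑ v, φ v ≤ 4 * T.cost G + Real.exp (5 / 2 * ℓ) := by
  have hb := O.leafBound_tree hℓ hout hφ hφ₀ T hT.1
  rw [hT.2, hT.leafSum_eq] at hb
  refine hb.le_add_one ?_
  -- What leaves the whole vertex set is uncontracted, so it is one edge at most; the highest
  -- vertex, having positive outgoing weight, owns it.
  suffices O.lowLeaving Set.univ = ∅ by rw [this, totalWeight_empty]; linarith
  obtain ⟨x, -⟩ := T.verts_nonempty
  obtain ⟨t, ht⟩ := O.exists_isTop (A := Set.univ) ⟨x, trivial⟩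
  have hdang : ∀ e ∈ O.leaving Set.univ, e ∈ G.dangling := fun e he =>
    (O.dangling_iff e).mpr (Option.eq_none_iff_forall_ne_some.mpr fun u => he.2 u trivial)
  have hne : (O.outEdges t).Nonempty := by
    by_contra hc
    have := hout t
    rw [Set.not_nonempty_iff_eq_empty.mp hc, totalWeight_empty] at this
    linarith
  obtain ⟨e, he⟩ := hne
  refine Set.eq_empty_iff_forall_notMem.mpr fun f hf => ?_
  have hef : e = f := hone (hdang e (ht.outEdges_subset O he)) (hdang f hf.1)
  exact Set.disjoint_left.mp (ht.disjoint_lowLeaving O) he (hef ▸ hf)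

/-- Each operand of a contraction is no larger than the contraction's cost, so the operands are paid
for twice over. Only the result of the tree is left unpaid. -/
lemma leafSum_exp_boundary_le_add (O : G.Orientation) :
    ∀ t : ContractionTree V, t.Proper →
      t.leafSum (fun v => Real.exp (G.totalWeight (G.boundary {v}))) ≤
        2 * t.cost G + Real.exp (G.totalWeight (G.boundary t.verts))
  | leaf v, _ => by simp [leafSum, verts, cost]
  | node l r, h => by
      have hl := leafSum_exp_boundary_le_add O l h.1
      have hr := leafSum_exp_boundary_le_add O r h.2.1
      have h₁ := Real.exp_le_exp.mpr (O.totalWeight_boundary_le_left h.2.2)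
      have h₂ := Real.exp_le_exp.mpr (O.totalWeight_boundary_le_right h.2.2)
      have h₃ := Real.exp_pos (G.totalWeight (G.boundary (node l r).verts))
      simp only [leafSum, cost] at *
      linarith

/-- The sizes of the tensors are bounded by twice the cost of contracting all of them. -/
theorem sum_exp_boundary_le_cost [Fintype V] [Nontrivial V] (O : G.Orientation)
    {T : ContractionTree V} (hT : T.IsFull) :
    ∑ v, Real.exp (G.totalWeight (G.boundary {v})) ≤ 2 * T.cost G := by
  rw [← hT.leafSum_eq fun v => Real.exp (G.totalWeight (G.boundary {v}))]
  cases T with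
  | leaf v =>
    obtain ⟨w, hw⟩ := exists_ne v
    exact absurd (hT.2.ge (Set.mem_univ w)) hw
  | node l r =>
    have h := hT.1
    have hl := O.leafSum_exp_boundary_le_add l h.1
    have hr := O.leafSum_exp_boundary_le_add r h.2.1
    have h₁ := Real.exp_le_exp.mpr (O.totalWeight_boundary_le_left h.2.2)
    have h₂ := Real.exp_le_exp.mpr (O.totalWeight_boundary_le_right h.2.2)
    simp only [leafSum, cost]
    linarith

end TensorNetwork.Orientation

lemma Finset.sum_le_prod_of_two_le {ι : Type*} {s : Finset ι} {f : ι → ℝ} (hs : s.Nonempty)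
    (hf : ∀ i ∈ s, 2 ≤ f i) : ∑ i ∈ s, f i ≤ ∏ i ∈ s, f i := by
  induction hs using Finset.Nonempty.cons_induction with
  | singleton a => simp
  | cons a s ha hs ih =>
    rw [Finset.sum_cons, Finset.prod_cons]
    have h₁ := ih fun i hi => hf i (Finset.mem_cons_of_mem hi)
    have h₂ := hf a (Finset.mem_cons_self a s)
    obtain ⟨i, hi⟩ := hs
    have h₃ : 2 ≤ ∑ i ∈ s, f i :=
      (hf i (Finset.mem_cons_of_mem hi)).trans (Finset.single_le_sum (f := f)
        (fun j hj => zero_le_two.trans (hf j (Finset.mem_cons_of_mem hj))) hi)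
    nlinarith

/-! ### Charging each edge to the contraction that absorbs it -/

namespace TensorNetwork.Orientation

open ContractionTree

variable {V E : Type*} {G : TensorNetwork V E}

/-- The edges with both ends in `A`. -/
def inner (O : G.Orientation) (A : Set V) : Set E :=
  {e | O.tail e ∈ A ∧ ∃ u ∈ A, O.head e = some u}

-- The edges `J` absorbed at one contraction lie in the boundaries of both operands, so they
-- contribute the product of their sizes, which dominates the sum as all sizes are at least 2.
open Classical in
lemma exp_mul_sum_inner_le_cost [Fintype E] [Finite V] (O : G.Orientation) {ℓ : ℝ}
    (hout : ∀ v, ℓ ≤ G.totalWeight (O.outEdges v)) (I : Finset E)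
    (hI : ∀ e ∈ I, 2 ≤ G.size e) :
    ∀ t : ContractionTree V, t.Proper →
      Real.exp ℓ * ∑ e ∈ I with e ∈ O.inner t.verts, (G.size e : ℝ) ≤ t.cost G
  | leaf v, _ => by
      rw [Finset.filter_false_of_mem]
      · simp [cost]
      · rintro e - ⟨h₁, u, h₂, h₃⟩
        have := O.rank_lt e u h₃
        simp only [verts, Set.mem_singleton_iff] at h₁ h₂
        simp [h₁, h₂] at this
  | node l r, h => by
      have hl := exp_mul_sum_inner_le_cost O hout I hI l h.1
      have hr := exp_mul_sum_inner_le_cost O hout I hI r h.2.1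
      set J : Finset E := {e ∈ I | e ∈ O.inner (node l r).verts ∧ e ∉ O.inner l.verts ∧
        e ∉ O.inner r.verts} with hJ
      have hsub : ∑ e ∈ I with e ∈ O.inner (node l r).verts, (G.size e : ℝ) ≤
          ∑ e ∈ I with e ∈ O.inner l.verts, (G.size e : ℝ) +
          ∑ e ∈ I with e ∈ O.inner r.verts, (G.size e : ℝ) + ∑ e ∈ J, (G.size e : ℝ) := by
        simp only [hJ, Finset.sum_filter]
        rw [← Finset.sum_add_distrib, ← Finset.sum_add_distrib]
        refine Finset.sum_le_sum fun e _ => ?_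
        have : (0 : ℝ) ≤ G.size e := Nat.cast_nonneg _
        by_cases h₁ : e ∈ O.inner (node l r).verts <;> by_cases h₂ : e ∈ O.inner l.verts <;>
          by_cases h₃ : e ∈ O.inner r.verts <;> simp [h₁, h₂, h₃]
      have hnew : Real.exp ℓ * ∑ e ∈ J, (G.size e : ℝ) ≤
          Real.exp (G.logCost l.verts r.verts) := by
        rcases J.eq_empty_or_nonempty with hJe | hJe
        · rw [hJe]; simp; positivity
        -- Outgoing edges of the highest vertex leave the union, so they are disjoint from the
        -- absorbed edges.
        obtain ⟨t, ht⟩ := O.exists_isTop (node l r).verts_nonempty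
        have hlog : G.totalWeight (O.outEdges t) + G.totalWeight (J : Set E) ≤
            G.logCost l.verts r.verts := by
          rw [O.logCost_eq h.2.2]
          have hd : ∀ v ∈ l.verts, v ∉ r.verts := fun _ h' => Set.disjoint_left.mp h.2.2 h'
          refine G.add_totalWeight_le ?_ ?_ ?_
          · rw [Set.disjoint_left]
            intro e he heJ
            rw [Finset.mem_coe, hJ, Finset.mem_filter] at heJ
            obtain ⟨-, ⟨-, u, hu, hh⟩, -⟩ := heJ
            have h₁ := O.rank_lt e u hh
            have h₂ := ht.2 u hu
            rw [show O.tail e = t from he] at h₁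
            omega
          · intro e he
            have h₁ := ht.outEdges_subset O he
            rw [O.boundary_eq, O.boundary_eq]
            simp only [leaving, verts, Set.mem_union, Set.mem_ofPred_eq] at h₁ ⊢
            grind
          · intro e heJ
            rw [Finset.mem_coe, hJ, Finset.mem_filter] at heJ
            rw [O.boundary_eq, O.boundary_eq]
            simp only [inner, leaving, entering, verts, Set.mem_union, Set.mem_ofPred_eq] at heJ ⊢
            grind
        have hw : G.totalWeight (J : Set E) = ∑ e ∈ J, Real.log (G.size e) := by
          simp [totalWeight, weight]
        calc Real.exp ℓ * ∑ e ∈ J, (G.size e : ℝ)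
            ≤ Real.exp ℓ * ∏ e ∈ J, (G.size e : ℝ) := by
              refine mul_le_mul_of_nonneg_left (Finset.sum_le_prod_of_two_le hJe fun e he => ?_)
                (Real.exp_nonneg _)
              exact_mod_cast hI e (Finset.mem_filter.mp he).1
          _ = Real.exp (ℓ + G.totalWeight (J : Set E)) := by
              rw [Real.exp_add, hw, Real.exp_sum]
              congr 1
              refine Finset.prod_congr rfl fun e _ => ?_
              rw [Real.exp_log (by exact_mod_cast G.size_pos e)]
          _ ≤ _ := Real.exp_le_exp.mpr (by linarith [hout t])
      have := mul_le_mul_of_nonneg_left hsub (Real.exp_nonneg ℓ)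
      simp only [cost]
      linarith

end TensorNetwork.Orientation

/-! ### From embeddings to orientations -/

namespace TensorNetwork

variable {V E : Type*}

lemma prod_size_le_exp_totalWeight [Fintype E] (G : TensorNetwork V E) {ι : Type*}
    (s : Finset ι) {g : ι → E} (hg : Function.Injective g) {F : Set E} (h : ∀ i ∈ s, g i ∈ F) :
    ∏ i ∈ s, (G.size (g i) : ℝ) ≤ Real.exp (G.totalWeight F) := by
  classical
  have hpos : ∀ e, (0 : ℝ) < G.size e := fun e => by exact_mod_cast G.size_pos e
  rw [← Real.log_le_iff_le_exp (Finset.prod_pos fun i _ => hpos _),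
    Real.log_prod fun i _ => (hpos _).ne']
  unfold totalWeight
  refine (Finset.sum_map s ⟨g, hg⟩ (fun e => Real.log (G.size e))).ge.trans ?_
  refine Finset.sum_le_sum_of_subset_of_nonneg ?_ fun e _ _ => G.weight_nonneg e
  intro e he
  obtain ⟨i, hi, rfl⟩ := Finset.mem_map.mp he
  simpa using h i hi

end TensorNetwork

lemma TNEmbedding.exists_tail_head {ι V F : Type*} (S : TNEmbedding ι V F) {n : ℕ}
    (ord : V ≃ Fin n) (f : F) :
    ∃ (a : V) (b : Option V), S.adj (.inr f) = {v | v = a ∨ b = some v} ∧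
      (.inr f ∈ S.dangling ↔ b = none) ∧ ∀ u, b = some u → ord a < ord u := by
  by_cases h : Sum.inr f ∈ S.dangling
  · obtain ⟨v, hv⟩ := S.adj_of_dangling _ h
    exact ⟨v, none, by rw [hv]; ext; simp, by simp [h], by simp⟩
  · obtain ⟨u, v, huv, hadj⟩ := S.adj_of_contracted _ h
    rcases (ord.injective.ne huv).lt_or_gt with hlt | hlt
    · exact ⟨u, some v, by rw [hadj]; ext; simp [eq_comm], by simp [h], by simpa using hlt⟩
    · exact ⟨v, some u, by rw [hadj]; ext; simp [eq_comm, or_comm], by simp [h],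
        by simpa using hlt⟩

/-- An ordering of the vertices of an embedding orients its network with the data, the vertices of
the data being the lowest ones. -/
lemma TNEmbedding.exists_orientation {N : ℕ} {s : Fin N → ℕ} (hs : ∀ j, 0 < s j) {V F : Type*}
    (S : TNEmbedding (Fin N) V F) {n : ℕ} (ord : V ≃ Fin n) :
    ∃ (O : ((kroneckerData s hs).attach S.toTensorNetwork).Orientation) (σ : Fin N → V),
      (∀ j, O.tail (.inl j) = .inl j) ∧ (∀ j, O.head (.inl j) = some (.inr (σ j))) ∧
      (∀ e j, O.head e ≠ some (.inl j)) ∧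
      ∀ v f, O.tail (.inr (.inr f)) = .inr v ↔ v ∈ S.adj (.inr f) ∧
        (.inr f ∈ S.dangling ∨ ∃ u ∈ S.adj (.inr f), ord v < ord u) := by
  choose σ hσ using fun j => S.adj_of_dangling _ (S.input_dangling j)
  choose t h hadj hdang hlt using fun f => S.exists_tail_head ord f
  refine ⟨{
    rank := Sum.elim (fun j => j) (fun v => N + ord v)
    tail := Sum.elim .inl (Sum.elim Empty.elim fun f => .inr (t f))
    head := Sum.elim (fun j => some (.inr (σ j))) (Sum.elim Empty.elim fun f => (h f).map .inr)
    rank_injective := ?_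
    adj_eq := ?_
    dangling_iff := ?_
    rank_lt := ?_ }, σ, fun j => rfl, fun j => rfl, ?_, ?_⟩
  · rintro (i | u) (j | v) huv
    · exact congrArg _ (Fin.ext huv)
    · have := i.2
      simp only [Sum.elim_inl, Sum.elim_inr] at huv
      omega
    · have := j.2
      simp only [Sum.elim_inl, Sum.elim_inr] at huv
      omega
    · simp only [Sum.elim_inr, Nat.add_left_cancel_iff] at huv
      exact congrArg _ (ord.injective (Fin.ext huv))
  · rintro (j | e | f)
    · ext (i | v) <;> simp [TensorNetwork.attach, kroneckerData, hσ, eq_comm]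
    · exact e.elim
    · ext (i | v) <;> simp [TensorNetwork.attach, hadj]
  · rintro (j | e | f)
    · simp [TensorNetwork.attach]
    · exact e.elim
    · simp [TensorNetwork.attach, hdang]
  · rintro (j | e | f) u hu
    · simp only [Sum.elim_inl, Option.some.injEq] at hu
      subst hu
      simp only [Sum.elim_inl, Sum.elim_inr]
      omega
    · exact e.elim
    · simp only [Sum.elim_inr, Option.map_eq_some_iff] at hu
      obtain ⟨v, hv, rfl⟩ := hu
      have := hlt f v hv
      simp only [Sum.elim_inr]
      omega
  · rintro (j | e | f) i
    · simp
    · exact e.elim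
    · simp
  · intro v f
    have h₁ := hdang f
    have h₂ := hlt f
    simp only [Sum.elim_inr, Sum.inr.injEq, hadj, Set.mem_ofPred_eq]
    cases hf : h f with
    | none => simp_all [eq_comm]
    | some u =>
      have h₃ := h₂ u hf
      simp only [hf, h₁, reduceCtorEq, false_or, Option.some.injEq]
      constructor
      · rintro rfl
        exact ⟨.inl rfl, u, .inr rfl, h₃⟩
      · rintro ⟨rfl | rfl, w, rfl | rfl, hw⟩
        · rfl
        · rfl
        · exact absurd hw h₃.asymm
        · exact absurd hw (lt_irrefl _)

lemma Nat.pow_four_le_mul_two_pow (d : ℕ) : d ^ 4 ≤ 21 * 2 ^ d := by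
  -- The ratio `d ^ 4 / 2 ^ d` peaks at `d = 6`, with value 20.25.
  rcases lt_or_ge d 6 with h | h
  · interval_cases d <;> norm_num
  · induction d, h using Nat.le_induction with
    | base => norm_num
    | succ k hk ih =>
      have : (k + 1) ^ 4 ≤ 2 * k ^ 4 := by
        obtain ⟨j, rfl⟩ := Nat.exists_eq_add_of_le hk
        ring_nf
        nlinarith [Nat.zero_le (j ^ 3), Nat.zero_le (j ^ 2)]
      rw [pow_succ 2 k]
      omega

/-! ### The three lower bounds for a sketched Kronecker product -/

section Bounds

variable {N : ℕ} {s : Fin N → ℕ} (hs : ∀ j, 0 < s j) {V F : Type*} [Fintype V] [Fintype F]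
  (S : TNEmbedding (Fin N) V F) {x : ℝ} {m : ℕ}

/-- The number of rows of every tensor is at least `x` in some linearization. -/
def TNEmbedding.RowSizeBound (x : ℝ) : Prop :=
  ∃ ord : V ≃ Fin (Fintype.card V), ∀ v, x ≤ S.rowSize ord v

variable {S}

lemma TNEmbedding.exists_orientation_of_rowSizeBound (hx : 0 < x) (hrow : S.RowSizeBound x)
    (hxs : ∀ j, x ≤ s j) :
    ∃ (O : ((kroneckerData s hs).attach S.toTensorNetwork).Orientation) (σ : Fin N → V),
      (∀ j, O.tail (.inl j) = .inl j) ∧ (∀ j, O.head (.inl j) = some (.inr (σ j))) ∧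
      (∀ e j, O.head e ≠ some (.inl j)) ∧
      ∀ v, Real.log x ≤
        ((kroneckerData s hs).attach S.toTensorNetwork).totalWeight (O.outEdges v) := by
  classical
  obtain ⟨ord, hord⟩ := hrow
  obtain ⟨O, σ, h₁, h₂, h₃, h₄⟩ := S.exists_orientation hs ord
  refine ⟨O, σ, h₁, h₂, h₃, ?_⟩
  rintro (j | v)
  · rw [Real.log_le_iff_le_exp hx]
    refine (hxs j).trans ?_
    have := ((kroneckerData s hs).attach S.toTensorNetwork).prod_size_le_exp_totalWeight
      {j} Sum.inl_injective (F := O.outEdges (.inl j))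
      (fun i hi => by rw [Finset.mem_singleton.mp hi]; exact h₁ j)
    rwa [Finset.prod_singleton] at this
  · rw [Real.log_le_iff_le_exp hx]
    refine (hord v).trans ?_
    have := ((kroneckerData s hs).attach S.toTensorNetwork).prod_size_le_exp_totalWeight
      {f : F | v ∈ S.adj (Sum.inr f) ∧
        (Sum.inr f ∈ S.dangling ∨ ∃ u ∈ S.adj (Sum.inr f), ord v < ord u)}
      (g := fun f => .inr (.inr f)) (Sum.inr_injective.comp Sum.inr_injective)
      (F := O.outEdges (.inr v))
      (fun f hf => (h₄ v f).mpr (Finset.mem_filter.mp hf).2)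
    unfold TNEmbedding.rowSize
    rw [Nat.cast_prod]
    refine le_of_eq_of_le (Finset.prod_congr ?_ fun f _ => rfl) this
    ext f
    simp only [Finset.mem_filter]

theorem mul_sum_le_cost (hx : 0 < x) (hrow : S.RowSizeBound x) (hxs : ∀ j, x ≤ s j)
    (hs₂ : ∀ j, 2 ≤ s j) {T : ContractionTree (Fin N ⊕ V)} (hT : T.IsFull) :
    x * ∑ j, (s j : ℝ) ≤ T.cost ((kroneckerData s hs).attach S.toTensorNetwork) := by
  classical
  obtain ⟨O, σ, h₁, h₂, -, hout⟩ := TNEmbedding.exists_orientation_of_rowSizeBound hs hx hrow hxs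
  have := O.exp_mul_sum_inner_le_cost hout (Finset.univ.map ⟨Sum.inl, Sum.inl_injective⟩)
    (fun e he => by
      obtain ⟨j, -, rfl⟩ := Finset.mem_map.mp he
      exact hs₂ j) T hT.1
  rw [Real.exp_log hx, Finset.filter_true_of_mem, Finset.sum_map] at this
  · exact this
  · intro e he
    obtain ⟨j, -, rfl⟩ := Finset.mem_map.mp he
    rw [hT.2]
    exact ⟨trivial, _, trivial, h₂ j⟩

theorem mul_rpow_le_cost (hN : 2 ≤ N) (hx : 0 < x) (hrow : S.RowSizeBound x)
    (hxs : ∀ j, x ≤ s j) (hs₂ : ∀ j, 2 ≤ s j) (hout : S.HasOutputSize m)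
    {T : ContractionTree (Fin N ⊕ V)} (hT : T.IsFull) :
    N * x ^ (5 / 2 : ℝ) ≤ 8 * T.cost ((kroneckerData s hs).attach S.toTensorNetwork) := by
  have hN' : (2 : ℝ) ≤ N := by exact_mod_cast hN
  -- The charging argument needs `log x > 0`. For `x ≤ 1` the linear bound is already stronger.
  rcases le_or_gt x 1 with hx₁ | hx₁
  · have h₁ := mul_sum_le_cost hs hx hrow hxs hs₂ hT
    have h₂ : x ^ (5 / 2 : ℝ) ≤ x := by
      simpa using Real.rpow_le_rpow_of_exponent_ge hx hx₁ (by norm_num : (1 : ℝ) ≤ 5 / 2)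
    have h₃ : (N : ℝ) ≤ ∑ j, (s j : ℝ) := by
      calc (N : ℝ) = ∑ j : Fin N, 1 := by simp
        _ ≤ _ := Finset.sum_le_sum fun j _ => by exact_mod_cast hs j
    have h₄ := T.cost_nonneg ((kroneckerData s hs).attach S.toTensorNetwork)
    nlinarith
  · obtain ⟨O, σ, h₁, h₂, h₃, hO⟩ := TNEmbedding.exists_orientation_of_rowSizeBound hs hx hrow hxs
    obtain ⟨f, hf, -⟩ := hout
    have hone : ((kroneckerData s hs).attach S.toTensorNetwork).dangling.Subsingleton := by
      have : ∀ e ∈ ((kroneckerData s hs).attach S.toTensorNetwork).dangling,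
          e = .inr (.inr f) := by
        rintro (j | e | g) he
        · exact he.elim
        · exact e.elim
        · rw [(hf g).mp he]
      intro e he e' he'
      rw [this e he, this e' he']
    have := O.exp_mul_sum_le_cost (Real.log_pos hx₁) hO hone
      (φ := Sum.elim (fun _ => 1) fun _ => 0) (by rintro (j | v) <;> simp)
      (by
        rintro (j | v) h
        · refine absurd h (not_lt.mpr (le_of_eq ?_))
          have : O.entering {.inl j} = ∅ := by
            refine Set.eq_empty_iff_forall_notMem.mpr ?_
            rintro e ⟨-, u, rfl, hu⟩
            exact h₃ e j hu
          rw [this, TensorNetwork.totalWeight_empty]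
        · simp) hT
    rw [Fintype.sum_sum_type] at this
    simp only [Sum.elim_inl, Sum.elim_inr, Finset.sum_const, Finset.card_univ, Fintype.card_fin,
      nsmul_eq_mul, mul_one, mul_zero, add_zero] at this
    rw [Real.rpow_def_of_pos hx, mul_comm (Real.log x)]
    -- The missing leaf is absorbed by `N ≤ 2 * (N - 1)`, which turns the factor 4 into 8.
    nlinarith [Real.exp_pos (5 / 2 * Real.log x)]

theorem rpow_div_card_le_cost (hN : 2 ≤ N) (hx : 0 < x) (hrow : S.RowSizeBound x)
    (hxs : ∀ j, x ≤ s j) (hm : 0 < m) (hms : ∀ j, m < s j) (hV : 4 * Fintype.card V ≤ N)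
    {T : ContractionTree (Fin N ⊕ V)} (hT : T.IsFull) :
    N * (x * (m : ℝ) ^ (3 / 2 : ℝ) * (N / (2 * Fintype.card V) : ℝ) ^ (5 / 2 : ℝ)) ≤
      336 * T.cost ((kroneckerData s hs).attach S.toTensorNetwork) := by
  classical
  have hor := TNEmbedding.exists_orientation_of_rowSizeBound hs hx hrow hxs
  set G := (kroneckerData s hs).attach S.toTensorNetwork
  obtain ⟨O, σ, h₁, h₂, -, hO⟩ := hor
  have hcard : 0 < Fintype.card V := Fintype.card_pos_iff.mpr ⟨σ ⟨0, by omega⟩⟩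
  have hcard' : (0 : ℝ) < Fintype.card V := by exact_mod_cast hcard
  have hm₁ : (1 : ℝ) ≤ m := by exact_mod_cast hm
  -- Half the average number of data edges per tensor: the excesses over `D` still add up to `N /
  -- 2`.
  set D : ℝ := N / (2 * Fintype.card V) with hD
  have hD₂ : 2 ≤ D := by
    rw [hD, le_div_iff₀ (by positivity)]
    have : (4 * Fintype.card V : ℝ) ≤ N := by exact_mod_cast hV
    linarith
  set J : V → Finset (Fin N) := fun v => {j | σ j = v} with hJ
  have hcut : ∀ v, x * ∏ j ∈ J v, (s j : ℝ) ≤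
      Real.exp (G.totalWeight (G.boundary {.inr v})) := by
    intro v
    have htop : O.IsTop {.inr v} (.inr v) := ⟨rfl, fun u hu => (congrArg O.rank hu).le⟩
    have hdis : Disjoint (O.outEdges (.inr v)) (O.entering {.inr v}) :=
      Set.disjoint_left.mpr fun e he he' => he'.1 he
    have hle := G.add_totalWeight_le hdis ((htop.outEdges_subset O).trans (O.leaving_subset _))
      (O.entering_subset _)
    have hprod := G.prod_size_le_exp_totalWeight (J v) (g := .inl) Sum.inl_injective
      (F := O.entering {.inr v}) (fun j hj => by
        have hj : σ j = v := by simpa [hJ] using hj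
        exact ⟨by simp [h₁], _, rfl, by rw [h₂, hj]⟩)
    calc x * ∏ j ∈ J v, (s j : ℝ)
        ≤ Real.exp (G.totalWeight (O.outEdges (.inr v))) *
          Real.exp (G.totalWeight (O.entering {.inr v})) :=
          mul_le_mul ((Real.log_le_iff_le_exp hx).mp (hO _)) hprod
            (Finset.prod_nonneg fun _ _ => Nat.cast_nonneg _) (Real.exp_nonneg _)
      _ ≤ _ := by rw [← Real.exp_add]; exact Real.exp_le_exp.mpr hle
  -- A minorant of the exponential size that is linear in the number of data edges, so that it can
  -- be summed knowing only their total. The constant is `84 = 4 * 21`.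
  have hpt : ∀ v, x * (m : ℝ) ^ (3 / 2 : ℝ) * D ^ (5 / 2 : ℝ) / 84 * ((J v).card - D) ≤
      Real.exp (G.totalWeight (G.boundary {.inr v})) := by
    intro v
    have hK : 0 ≤ x * (m : ℝ) ^ (3 / 2 : ℝ) * D ^ (5 / 2 : ℝ) / 84 := by positivity
    rcases le_or_gt ((J v).card : ℝ) D with hd | hd
    · exact (mul_nonpos_of_nonneg_of_nonpos hK (by linarith)).trans (Real.exp_nonneg _)
    refine le_trans ?_ (hcut v)
    set d := (J v).card with hd_def
    have hd₂ : 2 ≤ d := by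
      have : (2 : ℝ) < d := hD₂.trans_lt hd
      exact_mod_cast this.le
    -- Two factors supply the power of `m`; the others, each at least `m + 1 ≥ 2`, supply
    -- exponential growth in `d`.
    have hprod : (m : ℝ) ^ 2 * (2 : ℝ) ^ (d - 2) ≤ ∏ j ∈ J v, (s j : ℝ) := by
      set M : ℝ := m + 1 with hM
      calc (m : ℝ) ^ 2 * (2 : ℝ) ^ (d - 2) ≤ M ^ 2 * M ^ (d - 2) := by
            gcongr <;> linarith
        _ = ∏ j ∈ J v, M := by
            rw [← pow_add, Nat.add_sub_cancel' hd₂, Finset.prod_const]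
        _ ≤ _ := Finset.prod_le_prod (fun _ _ => by positivity) fun j _ => by
            rw [hM]; exact_mod_cast hms j
    have hpow : (d : ℝ) ^ 4 ≤ 84 * 2 ^ (d - 2) := by
      have h₁ : (d : ℝ) ^ 4 ≤ 21 * 2 ^ d := by exact_mod_cast Nat.pow_four_le_mul_two_pow d
      have h₂ : (2 : ℝ) ^ d = 2 ^ 2 * 2 ^ (d - 2) := by
        rw [← pow_add, Nat.add_sub_cancel' hd₂]
      rw [h₂] at h₁
      linarith
    have hD₃ : D ^ (5 / 2 : ℝ) ≤ (d : ℝ) ^ 3 := by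
      calc D ^ (5 / 2 : ℝ) ≤ (d : ℝ) ^ (5 / 2 : ℝ) := by gcongr
        _ ≤ (d : ℝ) ^ (3 : ℝ) :=
          Real.rpow_le_rpow_of_exponent_le (by linarith) (by norm_num)
        _ = (d : ℝ) ^ 3 := by norm_cast
    have hm₂ : (m : ℝ) ^ (3 / 2 : ℝ) ≤ (m : ℝ) ^ 2 := by
      calc (m : ℝ) ^ (3 / 2 : ℝ) ≤ (m : ℝ) ^ (2 : ℝ) :=
          Real.rpow_le_rpow_of_exponent_le hm₁ (by norm_num)
        _ = (m : ℝ) ^ 2 := by norm_cast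
    calc x * (m : ℝ) ^ (3 / 2 : ℝ) * D ^ (5 / 2 : ℝ) / 84 * (d - D)
        ≤ x * (m : ℝ) ^ 2 * (d : ℝ) ^ 3 / 84 * d := by
          gcongr
          linarith
      _ = x * ((m : ℝ) ^ 2 * ((d : ℝ) ^ 4 / 84)) := by ring
      _ ≤ x * ((m : ℝ) ^ 2 * (2 : ℝ) ^ (d - 2)) := by
          gcongr
          linarith
      _ ≤ _ := by gcongr
  have : Nontrivial (Fin N ⊕ V) :=
    ⟨.inl ⟨0, by omega⟩, .inr (σ ⟨0, by omega⟩), Sum.inl_ne_inr⟩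
  have hsum := O.sum_exp_boundary_le_cost hT
  rw [Fintype.sum_sum_type] at hsum
  have hnonneg : 0 ≤ ∑ j : Fin N, Real.exp (G.totalWeight (G.boundary {.inl j})) :=
    Finset.sum_nonneg fun _ _ => Real.exp_nonneg _
  have htot := Finset.sum_le_sum fun v (_ : v ∈ Finset.univ) => hpt v
  have hdeg : ∑ v, ((J v).card : ℝ) = N := by
    have := Finset.card_eq_sum_card_fiberwise (f := σ) (s := Finset.univ) (t := Finset.univ)
      (fun _ _ => Finset.mem_coe.mpr (Finset.mem_univ _))
    rw [Finset.card_univ, Fintype.card_fin] at this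
    exact_mod_cast this.symm
  rw [← Finset.mul_sum, Finset.sum_sub_distrib, hdeg, Finset.sum_const, Finset.card_univ,
    nsmul_eq_mul, show (Fintype.card V : ℝ) * D = N / 2 by rw [hD]; field_simp] at htot
  linarith

end Bounds

/-! ### Choice of constants and conclusion -/

theorem corollaryE1 (a b₁ b₂ : ℝ) (ha : 0 < a) (hb₁ : 0 < b₁) (hb₂ : 0 < b₂) :
    ∃ c : ℝ, 0 < c ∧
      ∀ (N : ℕ) (_ : 2 ≤ N) (ε δ : ℝ) (_ : 0 < ε) (_ : 0 < δ) (_ : δ < 1)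
        (s : Fin N → ℕ) (hs : ∀ j, 0 < s j)
        (V F : Type*) [Fintype V] [Fintype F] (S : TNEmbedding (Fin N) V F) (m : ℕ)
        (_ : ∀ j, S.size (Sum.inl j) = s j)
        (_ : S.Admissible a b₁ b₂ ε δ m)
        (_ : ∀ j, m < s j)
        (T : ContractionTree (Fin N ⊕ V)) (_ : T.IsFull),
        c * ((∑ j, (s j : ℝ) * m) + N * (m : ℝ) ^ (5 / 2 : ℝ)) ≤
            T.cost ((kroneckerData s hs).attach S.toTensorNetwork) ∧
          c * (N * (N * Real.log (1 / δ) / ε ^ 2) ^ (5 / 2 : ℝ)) ≤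
            T.cost ((kroneckerData s hs).attach S.toTensorNetwork) := by
  -- With `x = α * m`, the bound by `a / b₂` keeps `x` below every row size, through the upper bound
  -- on `m`, and the bound by 1 keeps it below every `s j`.
  set α : ℝ := min 1 (a / b₂)
  have hα : 0 < α := lt_min one_pos (div_pos ha hb₂)
  have hα₁ : α ≤ 1 := min_le_left _ _
  set K₁ : ℝ := α⁻¹ + 8 * (α⁻¹) ^ (5 / 2 : ℝ)
  set K₂ : ℝ := 336 * (2 / b₁) ^ (5 / 2 : ℝ) * α⁻¹
  set K₃ : ℝ := 8 * (4 / (b₁ * α)) ^ (5 / 2 : ℝ)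
  have hK₁ : 0 < K₁ := by positivity
  have hK₂ : 0 < K₂ := by positivity
  have hK₃ : 0 < K₃ := by positivity
  refine ⟨(K₁ + K₂ + K₃)⁻¹, by positivity, ?_⟩
  intro N hN ε δ hε hδ hδ₁ s hs V F _ _ S m _ hS hms T hT
  have hm : 0 < m := by
    obtain ⟨f, -, rfl⟩ := hS.output
    exact S.size_pos _
  have hm₁ : (0 : ℝ) < m := by exact_mod_cast hm
  have hx : 0 < α * m := by positivity
  have hs₂ : ∀ j, 2 ≤ s j := fun j => by have := hms j; omega
  have hxs : ∀ j, α * m ≤ s j := fun j => by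
    have : (m : ℝ) ≤ s j := by exact_mod_cast (hms j).le
    nlinarith
  have hrow : S.RowSizeBound (α * m) := by
    obtain ⟨ord, hord⟩ := hS.sufficient
    refine ⟨ord, fun v => le_trans ?_ (hord v)⟩
    calc α * m ≤ a / b₂ * m := by gcongr; exact min_le_right _ _
      _ ≤ a / b₂ * (b₂ * (Fintype.card V * Real.log (1 / δ) / ε ^ 2)) := by
        gcongr
        exact hS.upper
      _ = _ := by field_simp
  have hcost := T.cost_nonneg ((kroneckerData s hs).attach S.toTensorNetwork)
  have hsum := mul_sum_le_cost hs hx hrow hxs hs₂ hT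
  have hmain := mul_rpow_le_cost hs hN hx hrow hxs hs₂ hS.output hT
  have hfew := rpow_div_card_le_cost hs hN hx hrow hxs hm hms (hT := hT)
  have hV : 0 < Fintype.card V := by
    obtain ⟨v, -⟩ := S.adj_nonempty (.inl ⟨0, by omega⟩)
    exact Fintype.card_pos_iff.mpr ⟨v⟩
  have hlower := hS.lower
  generalize T.cost ((kroneckerData s hs).attach S.toTensorNetwork) = C at *
  rw [Real.mul_rpow hα.le hm₁.le] at hmain
  have hn : (0 : ℝ) < Fintype.card V := by exact_mod_cast hV
  set n : ℝ := (Fintype.card V : ℝ)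
  have hL : 0 < Real.log (1 / δ) := Real.log_pos ((one_lt_div hδ).mpr hδ₁)
  constructor
  · rw [inv_mul_le_iff₀ (by positivity)]
    have h₁ : ∑ j, (s j : ℝ) * m ≤ α⁻¹ * C := by
      rw [← Finset.sum_mul, le_inv_mul_iff₀ hα]
      linarith
    have h₂ : N * (m : ℝ) ^ (5 / 2 : ℝ) ≤ 8 * (α⁻¹) ^ (5 / 2 : ℝ) * C := by
      rw [Real.inv_rpow hα.le, mul_right_comm, ← div_eq_mul_inv, le_div_iff₀ (by positivity)]
      linarith
    calc _ ≤ K₁ * C := by rw [add_mul]; exact add_le_add h₁ h₂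
      _ ≤ _ := by gcongr; linarith
  · rw [inv_mul_le_iff₀ (by positivity)]
    have hle : N * Real.log (1 / δ) / ε ^ 2 ≤ N / n * m / b₁ := by
      rw [le_div_iff₀ hb₁, div_mul_eq_mul_div (N : ℝ) n, le_div_iff₀ hn]
      calc N * Real.log (1 / δ) / ε ^ 2 * b₁ * n
          = N * (b₁ * (n * Real.log (1 / δ) / ε ^ 2)) := by ring
        _ ≤ (N : ℝ) * m := by gcongr
    have hpow : (N : ℝ) * (N * Real.log (1 / δ) / ε ^ 2) ^ (5 / 2 : ℝ) ≤
        N * (N / n * m / b₁) ^ (5 / 2 : ℝ) := by gcongr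
    refine hpow.trans ?_
    -- With few tensors the loss `(N / n) ^ 2.5` is recovered from the tensor sizes; otherwise it is
    -- at most `4 ^ 2.5`.
    rcases le_or_gt (4 * Fintype.card V) N with h | h
    · have h₃ := hfew h
      have hm₃ : (m : ℝ) ^ (5 / 2 : ℝ) = m * (m : ℝ) ^ (3 / 2 : ℝ) := by
        rw [← Real.rpow_one_add' hm₁.le (by norm_num)]
        norm_num
      calc (N : ℝ) * (N / n * m / b₁) ^ (5 / 2 : ℝ)
          = N * (2 / b₁ * (N / (2 * n)) * m) ^ (5 / 2 : ℝ) := by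
            congr 2
            field_simp
        _ = (2 / b₁) ^ (5 / 2 : ℝ) * α⁻¹ *
            (N * (α * m * (m : ℝ) ^ (3 / 2 : ℝ) * (N / (2 * n)) ^ (5 / 2 : ℝ))) := by
            rw [Real.mul_rpow (by positivity) hm₁.le, Real.mul_rpow (by positivity) (by positivity),
              hm₃]
            field_simp
        _ ≤ (2 / b₁) ^ (5 / 2 : ℝ) * α⁻¹ * (336 * C) := by gcongr
        _ = K₂ * C := by ring
        _ ≤ _ := by gcongr; linarith
    · have hNn : N / n ≤ 4 := by
        rw [div_le_iff₀ hn]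
        have : (N : ℝ) ≤ 4 * (Fintype.card V : ℝ) := by exact_mod_cast h.le
        exact this
      calc (N : ℝ) * (N / n * m / b₁) ^ (5 / 2 : ℝ)
          ≤ N * (4 * m / b₁) ^ (5 / 2 : ℝ) := by gcongr
        _ = N * (4 / (b₁ * α) * (α * m)) ^ (5 / 2 : ℝ) := by
            congr 2
            field_simp
        _ = (4 / (b₁ * α)) ^ (5 / 2 : ℝ) * (N * (α ^ (5 / 2 : ℝ) * (m : ℝ) ^ (5 / 2 : ℝ))) := by
            rw [Real.mul_rpow (by positivity) hx.le, Real.mul_rpow hα.le hm₁.le]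
            ring
        _ ≤ (4 / (b₁ * α)) ^ (5 / 2 : ℝ) * (8 * C) := by gcongr
        _ = K₃ * C := by ring
        _ ≤ _ := by gcongr; linarith
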